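/- Let $\Lambda$ be a principal ideal domain and $p\in\Lambda$ a prime element. A pair $(B;A)$ consists of a finitely generated $\Lambda$-module $B$ and a submodule $A\subseteq B$; in addition we always assume $p^2A=0$. An isomorphism $(B;A)\cong(D;C)$ is a $\Lambda$-isomorphism $f:B\to D$ with $f(A)=C$. A pair $(B;A)$ is indecomposable if $B\neq 0$ and, whenever $B=B_1\oplus B_2$ and $A=A_1\oplus A_2$ with $A_i\subseteq B_i$, one has $B_1=0$ or $B_2=0$. For a nonzero element $a$ of a $\Lambda$-module $B$, the height exponent is $h_B(a)=\max\{n\ge 0 : a\in p^nB\}$; the height sequence $H_B(a)=(h_B(a),h_B(pa),\dots,h_B(p^{\ell}a))$ is the finite sequence of the height exponents of the nonzero elements among $a,pa,p^2a,\dots$ (defined when $a$ is annihilated by a power of $p$ and the maxima exist). By a power of a prime ideal we mean $P^k$ with $k\ge 1$ and $P$ a prime ideal, where $P=0$ is allowed. Every indecomposable pair $(B;A)$ with $p^2A=0$ is of exactly one of the following two kinds. (1) $(B;A)\cong(\Lambda/Q;0)$ for a unique power $Q$ of a prime ideal of $\Lambda$. (2) $A=a\Lambda$ for some nonzero $a\in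 B$. In this case, for each generator $a$ of $A$, the height sequence $H_B(a)$ exists and has length at most $2$, and it determines the pair up to isomorphism: if $(B;a\Lambda)$ and $(D;c\Lambda)$ are indecomposable pairs with $a,c\ne 0$ and $p^2a=0$, $p^2c=0$, then $(B;a\Lambda)\cong(D;c\Lambda)$ if and only if $H_B(a)=H_D(c)$. Conversely, for every power $Q$ of a prime ideal of $\Lambda$ the pair $(\Lambda/Q;0)$ is indecomposable. Moreover, the height sequence of a nonzero element of any $\Lambda$-module, whenever defined, is a nonempty strictly increasing finite sequence of non-negative integers, and every strictly increasing sequence of non-negative integers of length $1$ or $2$ equals $H_B(a)$ for some indecomposable pair $(B;a\Lambda)$ with $a\neq 0$ and $p^2a=0$. -/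

import Mathlib

namespace SubmodulePair

variable {R : Type*} [CommRing R] {M : Type*} [AddCommGroup M] [Module R M]
  {N : Type*} [AddCommGroup N] [Module R N]

/-- The pairs `(M; A)` and `(N; C)` are isomorphic: some linear isomorphism `M ≃ N` maps `A`
onto `C`. -/
def PairIso (A : Submodule R M) (C : Submodule R N) : Prop :=
  ∃ e : M ≃ₗ[R] N, A.map (e : M →ₗ[R] N) = C

/-- The pair `(M; A)` is indecomposable: `M` is nonzero, and whenever
`(M; A) = (M₁; A₁) ⊕ (M₂; A₂)`, that is `M = M₁ ⊕ M₂`, `A₁ ⊆ M₁`, `A₂ ⊆ M₂` and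
`A = A₁ ⊕ A₂`, one of the two summands is the zero pair. -/
def IsIndecomposablePair (A : Submodule R M) : Prop :=
  Nontrivial M ∧
    ∀ M₁ M₂ A₁ A₂ : Submodule R M, IsCompl M₁ M₂ → A₁ ≤ M₁ → A₂ ≤ M₂ → A = A₁ ⊔ A₂ →
      M₁ = ⊥ ∨ M₂ = ⊥

/-- `A` is `p ^ m`-bounded: `p ^ m A = 0`. -/
def IsPowBounded (p : R) (m : ℕ) (A : Submodule R M) : Prop :=
  ∀ a ∈ A, p ^ m • a = 0

/-- `h` is the height exponent of `a`: the largest `n` with `a ∈ p ^ n M`. -/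
def IsHeight (p : R) (a : M) (h : ℕ) : Prop :=
  IsGreatest {n : ℕ | ∃ b : M, a = p ^ n • b} h

/-- `l` is the height sequence of `a`: the finite sequence of the height exponents of the nonzero
elements among `a, p a, p² a, …`. -/
structure IsHeightSequence (p : R) (a : M) (l : List ℕ) : Prop where
  pow_length_smul_eq_zero : p ^ l.length • a = 0
  pow_smul_ne_zero : ∀ i < l.length, p ^ i • a ≠ 0
  isHeight : ∀ (i : ℕ) (hi : i < l.length), IsHeight p (p ^ i • a) l[i]

/-- `Q` is a power `P ^ k`, `k ≥ 1`, of a prime ideal `P` (the zero ideal of a domain is prime). -/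
def IsPrimeIdealPower (Q : Ideal R) : Prop :=
  ∃ P : Ideal R, P.IsPrime ∧ ∃ k : ℕ, 1 ≤ k ∧ Q = P ^ k

end SubmodulePair

open SubmodulePair

universe u v w

/-! For `A = 0` the statement is the structure theorem over a principal ideal domain. For `A ≠ 0`
the idea is to split off from `(B; A)` one explicit cyclic pair, which by indecomposability is
everything.

The models `(M; m)` are `Λ/p^(h+1)` with `m = p^h` (heights `h`), `Λ/p^(h+2)` with `m = p^h`
(heights `h, h+1`), and, when `h + 1 < k`, `Λ/p^(k+1) ⊕ Λ/p^(h+1)` with `m = (p^(k-1), p^h)`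
(heights `h, k`). Each is rigid: an endomorphism fixing `m` is injective
(`IsModelExponents.injective_of_fix`). Rigidity makes the model indecomposable. As `M` is Artinian,
it also turns maps `ψ : M → B` and `φ : B → M` with `φ (ψ m) = m`, `ψ m ∈ A` and `φ A ⊆ ⟨m⟩` into a
splitting.

Let `i + 1` be the exponent of `A`. Choose `a ∈ A` with `p^i a ≠ 0` so that the height `k` of `p^i
a` is maximal, and then the height `h` of `a` is maximal (`exists_splitting_element`). These heights
provide `ψ` with `ψ m = a`. Maximality gives `p^i a ∉ (A ∩ p^(k+1) B) + p^i (A ∩ p^(h+1) B)`, so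
some functional on `A` with values in `Λ/p^(i+1)` sends `a` to `1` and kills this sum. Composed with
`1 ↦ m` it becomes a map `A → M`. Each coordinate extends to `B`, because `Λ/p^n` is injective among
modules killed by `p^n`; this is `φ`. -/

namespace SubmodulePair

/-! ### Cyclic modules `Λ/p^n` and extension of maps into them -/

section PID

variable {Λ : Type u} [CommRing Λ]

/-- The cyclic module `Λ / p ^ n`. -/
abbrev QuotPow (p : Λ) (n : ℕ) : Type u := Λ ⧸ Ideal.span {p ^ n}

namespace QuotPow

variable {p : Λ}

theorem mk_eq_zero {n : ℕ} {x : Λ} :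
    (Ideal.Quotient.mk (Ideal.span {p ^ n}) x : QuotPow p n) = 0 ↔ p ^ n ∣ x := by
  rw [Ideal.Quotient.eq_zero_iff_mem, Ideal.mem_span_singleton]

theorem smul_mk {n : ℕ} (r x : Λ) :
    r • (Ideal.Quotient.mk (Ideal.span {p ^ n}) x : QuotPow p n)
      = Ideal.Quotient.mk (Ideal.span {p ^ n}) (r * x) := rfl

theorem pow_smul_eq_zero {m n : ℕ} (h : n ≤ m) (x : QuotPow p n) : p ^ m • x = 0 := by
  obtain ⟨x, rfl⟩ := Ideal.Quotient.mk_surjective x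
  rw [smul_mk, mk_eq_zero]
  exact (pow_dvd_pow p h).mul_right x

variable [IsDomain Λ]

theorem mk_pow_ne_zero (hp : Prime p) {j n : ℕ} (h : j < n) :
    (Ideal.Quotient.mk (Ideal.span {p ^ n}) (p ^ j) : QuotPow p n) ≠ 0 := by
  rw [Ne, mk_eq_zero, pow_dvd_pow_iff hp.ne_zero hp.not_isUnit]
  omega

theorem exists_eq_pow_smul (hp : Prime p) {j n : ℕ} (h : j ≤ n) {x : QuotPow p n}
    (hx : p ^ j • x = 0) : ∃ z : QuotPow p n, x = p ^ (n - j) • z := by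
  obtain ⟨x, rfl⟩ := Ideal.Quotient.mk_surjective x
  rw [smul_mk, mk_eq_zero, ← Nat.add_sub_cancel' h, pow_add,
    mul_dvd_mul_iff_left (pow_ne_zero _ hp.ne_zero)] at hx
  obtain ⟨z, rfl⟩ := hx
  exact ⟨Ideal.Quotient.mk _ z, (smul_mk _ _).symm⟩

variable [IsPrincipalIdealRing Λ]

/-- If `t = p^n u` with `p ∤ u`, a Bézout inverse of `u` modulo `p` serves as `r`. If `t` is
divisible by a smaller power of `p` only, the multiplier found for that power is scaled by `p`. -/
theorem exists_dvd_mul_sub (hp : Prime p) (n : ℕ) {t : Λ} (ht : ¬ p ^ (n + 1) ∣ t) :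
    ∃ r : Λ, p ^ (n + 1) ∣ r * t - p ^ n := by
  have key : ∀ m : ℕ, ∀ u : Λ, ¬ p ∣ u → ∃ r : Λ, p ^ (m + 1) ∣ r * (p ^ m * u) - p ^ m := by
    intro m u hu
    obtain ⟨a, b, hab⟩ := (hp.irreducible.coprime_iff_not_dvd).2 hu
    refine ⟨b, -a, ?_⟩
    linear_combination p ^ m * hab
  induction n with
  | zero => simpa using key 0 t (by simpa using ht)
  | succ n ih =>
    by_cases h : p ^ (n + 1) ∣ t
    · obtain ⟨u, rfl⟩ := h
      refine key (n + 1) u fun hu ↦ ht ?_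
      rw [pow_succ]
      exact mul_dvd_mul_left _ hu
    · obtain ⟨r, w, hw⟩ := ih h
      refine ⟨p * r, w, ?_⟩
      linear_combination p * hw

/-- Every nonzero element of `Λ / p ^ (n + 1)` has the generator `p ^ n` of the socle as a
multiple. -/
theorem exists_smul_eq (hp : Prime p) {n : ℕ} {x : QuotPow p (n + 1)} (hx : x ≠ 0) :
    ∃ r : Λ, r • x = Ideal.Quotient.mk _ (p ^ n) := by
  obtain ⟨t, rfl⟩ := Ideal.Quotient.mk_surjective x
  obtain ⟨r, hr⟩ := exists_dvd_mul_sub hp n (mt mk_eq_zero.2 hx)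
  refine ⟨r, ?_⟩
  rw [smul_mk, ← sub_eq_zero, ← map_sub, mk_eq_zero]
  exact hr

theorem isArtinian (hp : Prime p) (n : ℕ) : IsArtinian Λ (QuotPow p n) :=
  (isFiniteLength_iff_isNoetherian_isArtinian.1 (isFiniteLength_quotient_span_singleton Λ
    (mem_nonZeroDivisors_of_ne_zero (pow_ne_zero n hp.ne_zero)))).2

end QuotPow

/-- A divisible module over a principal ideal ring satisfies Baer's criterion. -/
theorem baer_of_divisible [IsPrincipalIdealRing Λ] {E : Type*} [AddCommGroup E] [Module Λ E]
    (h : ∀ r : Λ, r ≠ 0 → ∀ y : E, ∃ z : E, r • z = y) : Module.Baer Λ E := by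
  intro I g
  obtain ⟨r, rfl⟩ := IsPrincipalIdealRing.principal I
  by_cases hr : r = 0
  · subst hr
    refine ⟨0, fun x hx ↦ ?_⟩
    have : (⟨x, hx⟩ : Submodule.span Λ {(0 : Λ)}) = 0 := by
      ext
      simpa using hx
    rw [this, map_zero, LinearMap.zero_apply]
  · obtain ⟨z, hz⟩ := h r hr (g ⟨r, Submodule.mem_span_singleton_self r⟩)
    refine ⟨LinearMap.toSpanSingleton Λ E z, fun x hx ↦ ?_⟩
    obtain ⟨s, rfl⟩ := Submodule.mem_span_singleton.1 hx
    rw [LinearMap.toSpanSingleton_apply, smul_assoc, hz, ← map_smul]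
    rfl

variable [IsDomain Λ] [IsPrincipalIdealRing Λ]

/-- `Λ / p ^ n` is injective among the modules annihilated by `p ^ n`. -/
theorem exists_extension_of_injective {p : Λ} (hp : Prime p) (n : ℕ) {C B : Type*}
    [AddCommGroup C] [Module Λ C] [AddCommGroup B] [Module Λ B] (hB : ∀ b : B, p ^ n • b = 0)
    (j : C →ₗ[Λ] B) (hj : Function.Injective j) (g : C →ₗ[Λ] QuotPow p n) :
    ∃ φ : B →ₗ[Λ] QuotPow p n, φ ∘ₗ j = g := by
  -- `K/Λ` is divisible, hence injective, and `1 ↦ 1/p^n` identifies `Λ/p^n` with its `p^n`-torsion.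
  let K := FractionRing Λ
  let E := K ⧸ LinearMap.range (Algebra.linearMap Λ K)
  have hpn : algebraMap Λ K (p ^ n) ≠ 0 := by
    simpa using pow_ne_zero n hp.ne_zero
  have hE : Module.Baer Λ E := by
    refine baer_of_divisible fun r hr y ↦ ?_
    obtain ⟨y, rfl⟩ := Submodule.Quotient.mk_surjective _ y
    refine ⟨Submodule.Quotient.mk ((algebraMap Λ K r)⁻¹ * y), ?_⟩
    have hr' : algebraMap Λ K r ≠ 0 := by simpa using hr
    rw [← Submodule.Quotient.mk_smul, Algebra.smul_def, mul_inv_cancel_left₀ hr']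
  let d : Λ →ₗ[Λ] E := LinearMap.toSpanSingleton Λ E
    (Submodule.Quotient.mk (algebraMap Λ K (p ^ n))⁻¹)
  have hd : ∀ r, d r = 0 ↔ r ∈ Ideal.span {p ^ n} := by
    intro r
    rw [LinearMap.toSpanSingleton_apply, ← Submodule.Quotient.mk_smul,
      Submodule.Quotient.mk_eq_zero, LinearMap.mem_range, Ideal.mem_span_singleton]
    refine exists_congr fun s ↦ ?_
    rw [Algebra.linearMap_apply, Algebra.smul_def, eq_mul_inv_iff_mul_eq₀ hpn, ← map_mul,
      (IsFractionRing.injective Λ K).eq_iff, mul_comm, eq_comm]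
  let i : QuotPow p n →ₗ[Λ] E := Submodule.liftQ _ d fun r hr ↦ (hd r).2 hr
  have hi : Function.Injective i := by
    rw [← LinearMap.ker_eq_bot]
    exact Submodule.ker_liftQ_eq_bot _ _ _ fun r hr ↦ (hd r).1 hr
  obtain ⟨φ, hφ⟩ := hE.extension_property j hj (i ∘ₗ g)
  -- Since `p^n B = 0`, every value of `φ` is `p^n`-torsion, hence of the form `s/p^n` modulo `Λ`.
  have hrange : ∀ b, φ b ∈ LinearMap.range i := by
    intro b
    obtain ⟨y, hy⟩ := Submodule.Quotient.mk_surjective _ (φ b)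
    have h0 : p ^ n • φ b = 0 := by rw [← map_smul, hB, map_zero]
    rw [← hy, ← Submodule.Quotient.mk_smul, Submodule.Quotient.mk_eq_zero] at h0
    obtain ⟨s, hs⟩ := h0
    refine ⟨Submodule.Quotient.mk s, ?_⟩
    rw [← hy]
    change Submodule.Quotient.mk (s • (algebraMap Λ K (p ^ n))⁻¹) = _
    congr 1
    rw [Algebra.smul_def, ← Algebra.linearMap_apply, hs, Algebra.smul_def, mul_comm,
      inv_mul_cancel_left₀ hpn]
  refine ⟨(LinearEquiv.ofInjective i hi).symm ∘ₗ φ.codRestrict _ hrange, ?_⟩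
  ext c
  refine (LinearEquiv.symm_apply_eq (LinearEquiv.ofInjective i hi)).2 (Subtype.ext ?_)
  exact LinearMap.congr_fun hφ c

/-- A map from a submodule of `B` to `Λ / p ^ n` extends to `B` as soon as it vanishes on
`p ^ n B`. -/
theorem exists_extension_of_submodule {p : Λ} (hp : Prime p) (n : ℕ) {B : Type*}
    [AddCommGroup B] [Module Λ B] (C : Submodule Λ B) (g : C →ₗ[Λ] QuotPow p n)
    (hg : ∀ x : C, (∃ b : B, (x : B) = p ^ n • b) → g x = 0) :
    ∃ φ : B →ₗ[Λ] QuotPow p n, ∀ x : C, φ x = g x := by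
  -- `C/(C ∩ p^n B)` embeds in `B/p^n B`, which is annihilated by `p^n`.
  let P : Submodule Λ B := LinearMap.range (LinearMap.lsmul Λ B (p ^ n))
  have hP : ∀ x, x ∈ P ↔ ∃ b : B, x = p ^ n • b := fun x ↦ by
    simp [P, LinearMap.mem_range, eq_comm]
  let g' : (C ⧸ P.comap C.subtype) →ₗ[Λ] QuotPow p n :=
    Submodule.liftQ _ g fun x hx ↦ hg x ((hP _).1 hx)
  obtain ⟨φ, hφ⟩ := exists_extension_of_injective hp n (B := B ⧸ P) (fun b ↦ by
    obtain ⟨b, rfl⟩ := Submodule.Quotient.mk_surjective _ b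
    rw [← Submodule.Quotient.mk_smul, Submodule.Quotient.mk_eq_zero]
    exact (hP _).2 ⟨b, rfl⟩) (Submodule.mapQ (P.comap C.subtype) P C.subtype le_rfl)
    (by
      rw [← LinearMap.ker_eq_bot]
      refine Submodule.ker_liftQ_eq_bot _ _ _ fun x hx ↦ ?_
      simpa using hx) g'
  exact ⟨φ ∘ₗ P.mkQ, fun x ↦ LinearMap.congr_fun hφ (Submodule.Quotient.mk x)⟩

/-- An element of order `p ^ (i + 1)` modulo `K` in a module annihilated by `p ^ (i + 1)` maps to
`1` under some functional to `Λ / p ^ (i + 1)` that vanishes on `K`. -/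
theorem exists_functional {p : Λ} (hp : Prime p) (i : ℕ) {N : Type*} [AddCommGroup N] [Module Λ N]
    (hN : ∀ b : N, p ^ (i + 1) • b = 0) (K : Submodule Λ N) (a : N) (ha : p ^ i • a ∉ K) :
    ∃ f : N →ₗ[Λ] QuotPow p (i + 1), f a = 1 ∧ ∀ x ∈ K, f x = 0 := by
  let d : Λ →ₗ[Λ] N ⧸ K := LinearMap.toSpanSingleton Λ _ (Submodule.Quotient.mk a)
  have hN' : ∀ b : N ⧸ K, p ^ (i + 1) • b = 0 := fun b ↦ by
    obtain ⟨b, rfl⟩ := Submodule.Quotient.mk_surjective _ b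
    rw [← Submodule.Quotient.mk_smul, hN, Submodule.Quotient.mk_zero]
  have hle : Ideal.span {p ^ (i + 1)} ≤ LinearMap.ker d := by
    rw [Ideal.span_le, Set.singleton_subset_iff]
    exact hN' _
  obtain ⟨φ, hφ⟩ := exists_extension_of_injective hp (i + 1) hN'
    (Submodule.liftQ (Ideal.span {p ^ (i + 1)}) d hle)
    (by
      rw [← LinearMap.ker_eq_bot]
      refine Submodule.ker_liftQ_eq_bot _ _ _ fun r hr ↦ ?_
      -- A relation `r a ∈ K` with `p^(i+1) ∤ r` has a multiple congruent to `p^i a`, contradicting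
      -- `p^i a ∉ K`.
      by_contra h
      rw [Ideal.mem_span_singleton] at h
      obtain ⟨s, hs⟩ := QuotPow.exists_dvd_mul_sub hp i h
      have h1 : d (s * r - p ^ i) = 0 := hle (Ideal.mem_span_singleton.2 hs)
      have h2 : d (s * r) = 0 := by
        rw [← smul_eq_mul, map_smul, LinearMap.mem_ker.1 hr, smul_zero]
      rw [map_sub, h2, zero_sub, neg_eq_zero, LinearMap.toSpanSingleton_apply,
        ← Submodule.Quotient.mk_smul, Submodule.Quotient.mk_eq_zero] at h1
      exact ha h1) LinearMap.id
  refine ⟨φ ∘ₗ K.mkQ, ?_, fun x hx ↦ ?_⟩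
  · have := LinearMap.congr_fun hφ (Submodule.Quotient.mk 1)
    rw [LinearMap.comp_apply, Submodule.liftQ_apply, LinearMap.toSpanSingleton_apply,
      one_smul] at this
    exact this
  · rw [LinearMap.comp_apply, Submodule.mkQ_apply, (Submodule.Quotient.mk_eq_zero K).2 hx, map_zero]

end PID

/-! ### Retracts of pairs and rigidity -/

section Pairs

variable {R : Type*} [CommRing R] {M : Type*} [AddCommGroup M] [Module R M]
  {N : Type*} [AddCommGroup N] [Module R N] {L : Type*} [AddCommGroup L] [Module R L]

theorem PairIso.symm {A : Submodule R M} {C : Submodule R N} (h : PairIso A C) : PairIso C A := by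
  obtain ⟨e, rfl⟩ := h
  refine ⟨e.symm, ?_⟩
  rw [← Submodule.map_comp, LinearEquiv.symm_comp, Submodule.map_id]

theorem PairIso.trans {A : Submodule R M} {C : Submodule R N} {D : Submodule R L}
    (h : PairIso A C) (h' : PairIso C D) : PairIso A D := by
  obtain ⟨e, rfl⟩ := h
  obtain ⟨e', rfl⟩ := h'
  exact ⟨e.trans e', by rw [← Submodule.map_comp]; rfl⟩

/-- A nonzero pair retract of an indecomposable pair is everything. -/
theorem IsIndecomposablePair.exists_equiv_of_retract {A : Submodule R N}
    (hA : IsIndecomposablePair A) [Nontrivial M] (φ : N →ₗ[R] M) (ψ : M →ₗ[R] N)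
    (hφψ : ∀ x, φ (ψ x) = x) (hψφ : ∀ x ∈ A, ψ (φ x) ∈ A) : ∃ e : M ≃ₗ[R] N, ∀ x, e x = ψ x := by
  have hc : IsCompl (LinearMap.range ψ) (LinearMap.ker φ) := by
    refine ⟨Submodule.disjoint_def.2 ?_, Submodule.codisjoint_iff_exists_add_eq.2 fun x ↦ ?_⟩
    · rintro _ ⟨y, rfl⟩ hy
      rw [LinearMap.mem_ker, hφψ] at hy
      rw [hy, map_zero]
    · refine ⟨ψ (φ x), x - ψ (φ x), ⟨_, rfl⟩, ?_, by abel⟩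
      rw [LinearMap.mem_ker, map_sub, hφψ, sub_self]
  have hsum : A = A ⊓ LinearMap.range ψ ⊔ A ⊓ LinearMap.ker φ := by
    refine le_antisymm (fun x hx ↦ ?_) (sup_le inf_le_left inf_le_left)
    refine Submodule.mem_sup.2 ⟨ψ (φ x), ⟨hψφ x hx, _, rfl⟩, x - ψ (φ x),
      ⟨A.sub_mem hx (hψφ x hx), ?_⟩, by abel⟩
    rw [SetLike.mem_coe, LinearMap.mem_ker, map_sub, hφψ, sub_self]
  have hinj : Function.Injective ψ := Function.LeftInverse.injective hφψ
  rcases hA.2 _ _ _ _ hc inf_le_right inf_le_right hsum with h | h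
  · obtain ⟨x, hx⟩ := exists_ne (0 : M)
    rw [LinearMap.range_eq_bot] at h
    exact absurd (hinj (by simp [h])) hx
  · refine ⟨LinearEquiv.ofBijective ψ ⟨hinj, fun y ↦ ⟨φ y, ?_⟩⟩, fun x ↦ rfl⟩
    exact (LinearMap.ker_eq_bot.1 h) (hφψ _)

/-- If `m` is nonzero and every endomorphism of the Artinian module `M` fixing `m` is injective,
then a pair retraction onto `(M; m)` exhibits an indecomposable pair as `(M; m)`. -/
theorem IsIndecomposablePair.exists_equiv_of_rigid {A : Submodule R N}
    (hA : IsIndecomposablePair A) [IsArtinian R M] {m : M} (hm : m ≠ 0)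
    (hrigid : ∀ θ : M →ₗ[R] M, θ m = m → Function.Injective θ)
    (φ : N →ₗ[R] M) (ψ : M →ₗ[R] N) (hψ : ψ m ∈ A) (hφ : φ (ψ m) = m)
    (hφA : ∀ x ∈ A, φ x ∈ Submodule.span R {m}) :
    ∃ e : M ≃ₗ[R] N, e m = ψ m ∧ A = Submodule.span R {ψ m} := by
  -- `φ ∘ ψ` fixes `m`, so it is injective and hence bijective; `ψ ∘ θ⁻¹` is then a true section of
  -- `φ` that still sends `m` to `ψ m`.
  let θ : M ≃ₗ[R] M := LinearEquiv.ofBijective (φ ∘ₗ ψ)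
    (IsArtinian.bijective_of_injective_endomorphism _ (hrigid _ hφ))
  have hθ : ∀ x, φ (ψ x) = θ x := fun _ ↦ rfl
  have hθm : θ.symm m = m := θ.symm_apply_eq.2 hφ.symm
  have : Nontrivial M := ⟨m, 0, hm⟩
  obtain ⟨e, he⟩ := hA.exists_equiv_of_retract φ (ψ ∘ₗ θ.symm)
    (fun x ↦ by rw [LinearMap.comp_apply, hθ]; exact θ.apply_symm_apply x) (fun x hx ↦ by
      obtain ⟨r, hr⟩ := Submodule.mem_span_singleton.1 (hφA x hx)
      rw [← hr, map_smul, LinearMap.comp_apply, LinearEquiv.coe_coe, hθm]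
      exact A.smul_mem r hψ)
  have hem : e m = ψ m := by rw [he, LinearMap.comp_apply, LinearEquiv.coe_coe, hθm]
  refine ⟨e, hem, le_antisymm (fun x hx ↦ ?_) ((Submodule.span_singleton_le_iff_mem _ _).2 hψ)⟩
  have hφe : ∀ y, φ (e y) = y := fun y ↦ by
    rw [he, LinearMap.comp_apply, hθ]; exact θ.apply_symm_apply y
  obtain ⟨y, rfl⟩ := e.surjective x
  obtain ⟨r, hr⟩ := Submodule.mem_span_singleton.1 (hφA _ hx)
  rw [hφe] at hr
  rw [← hr, map_smul, hem]
  exact Submodule.smul_mem _ _ (Submodule.mem_span_singleton_self _)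

/-- If every endomorphism fixing `m` is injective and the nonzero elements of `⟨m⟩` have a common
nonzero multiple `s`, then `(M; m)` is indecomposable. -/
theorem isIndecomposablePair_of_rigid {m : M} (hm : m ≠ 0)
    (hrigid : ∀ θ : M →ₗ[R] M, θ m = m → Function.Injective θ) {s : M} (hs : s ≠ 0)
    (hsoc : ∀ x ∈ Submodule.span R {m}, x ≠ 0 → s ∈ Submodule.span R {x}) :
    IsIndecomposablePair (Submodule.span R {m}) := by
  -- The projection onto a summand containing `m` fixes `m`, so it is injective and the complement
  -- vanishes.
  have key : ∀ M₁ M₂ : Submodule R M, IsCompl M₁ M₂ → m ∈ M₁ → M₂ = ⊥ := by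
    intro M₁ M₂ hc hm₁
    have hfix : (M₁.subtype ∘ₗ M₁.projectionOnto M₂ hc) m = m := by
      have := Submodule.projectionOnto_apply_left hc ⟨m, hm₁⟩
      simp only [LinearMap.comp_apply] at this ⊢
      rw [this]
      rfl
    rw [Submodule.eq_bot_iff]
    intro x hx
    refine hrigid _ hfix ?_
    rw [LinearMap.comp_apply, (Submodule.projectionOnto_apply_eq_zero_iff hc).2 hx, map_zero,
      map_zero]
  refine ⟨⟨m, 0, hm⟩, fun M₁ M₂ A₁ A₂ hc h₁ h₂ hA ↦ ?_⟩
  by_cases h : A₂ = ⊥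
  · right
    refine key M₁ M₂ hc (h₁ ?_)
    rw [h, sup_bot_eq] at hA
    exact hA ▸ Submodule.mem_span_singleton_self m
  by_cases h' : A₁ = ⊥
  · left
    refine key M₂ M₁ hc.symm (h₂ ?_)
    rw [h', bot_sup_eq] at hA
    exact hA ▸ Submodule.mem_span_singleton_self m
  -- If both `A₁` and `A₂` were nonzero, both would contain `s`.
  have hmem : ∀ C : Submodule R M, C ≤ Submodule.span R {m} → C ≠ ⊥ → s ∈ C := by
    intro C hC hne
    obtain ⟨x, hx, hx0⟩ := C.ne_bot_iff.1 hne
    exact (Submodule.span_singleton_le_iff_mem _ _).2 hx (hsoc x (hC hx) hx0)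
  exact absurd (Submodule.disjoint_def.1 hc.disjoint s
    (h₁ (hmem A₁ (hA ▸ le_sup_left) h')) (h₂ (hmem A₂ (hA ▸ le_sup_right) h))) hs

end Pairs

/-! ### Height sequences and the choice of a splitting element -/

section Heights

variable {R : Type*} [CommRing R] {M : Type*} [AddCommGroup M] [Module R M]
  {N : Type*} [AddCommGroup N] [Module R N] {p : R}

theorem exists_pow_smul_of_le {x : M} {m n : ℕ} (h : m ≤ n) (hx : ∃ b, x = p ^ n • b) :
    ∃ b, x = p ^ m • b := by
  obtain ⟨b, rfl⟩ := hx
  exact ⟨p ^ (n - m) • b, by rw [smul_smul, ← pow_add, Nat.add_sub_cancel' h]⟩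

theorem isHeight_iff {x : M} {h : ℕ} :
    IsHeight p x h ↔ (∃ b, x = p ^ h • b) ∧ ¬ ∃ b, x = p ^ (h + 1) • b := by
  refine ⟨fun H ↦ ⟨H.1, fun hb ↦ ?_⟩, fun H ↦ ⟨H.1, fun n hn ↦ ?_⟩⟩
  · exact absurd (H.2 hb) (by omega)
  · by_contra hlt
    exact H.2 (exists_pow_smul_of_le (by omega) hn)

theorem IsHeightSequence.ne_nil {x : M} {l : List ℕ} (hx : x ≠ 0) (h : IsHeightSequence p x l) :
    l ≠ [] := by
  rintro rfl
  exact hx (by simpa using h.pow_length_smul_eq_zero)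

theorem IsHeightSequence.pairwise {x : M} {l : List ℕ} (h : IsHeightSequence p x l) :
    l.Pairwise (· < ·) := by
  rw [← List.isChain_iff_pairwise, List.isChain_iff_getElem]
  intro i hi
  obtain ⟨b, hb⟩ := (h.isHeight i (by omega)).1
  refine Nat.lt_of_succ_le ((h.isHeight (i + 1) hi).2 ⟨b, ?_⟩)
  rw [pow_succ', mul_smul, hb, smul_smul, Nat.succ_eq_add_one, pow_succ' p (l[i])]

theorem IsHeightSequence.unique {x : M} {l l' : List ℕ} (h : IsHeightSequence p x l)
    (h' : IsHeightSequence p x l') : l = l' := by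
  have hlen : l.length = l'.length := by
    refine le_antisymm ?_ ?_ <;> by_contra! hlt
    · exact h.pow_smul_ne_zero _ hlt h'.pow_length_smul_eq_zero
    · exact h'.pow_smul_ne_zero _ hlt h.pow_length_smul_eq_zero
  exact List.ext_getElem hlen fun i hi hi' ↦ (h.isHeight i hi).unique (h'.isHeight i hi')

theorem IsHeightSequence.map_equiv {x : M} {l : List ℕ} (h : IsHeightSequence p x l)
    (e : M ≃ₗ[R] N) : IsHeightSequence p (e x) l where
  pow_length_smul_eq_zero := by rw [← map_smul, h.pow_length_smul_eq_zero, map_zero]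
  pow_smul_ne_zero i hi := by
    rw [← map_smul, Ne, LinearEquiv.map_eq_zero_iff]
    exact h.pow_smul_ne_zero i hi
  isHeight i hi := by
    have hset : {n : ℕ | ∃ b : N, p ^ i • e x = p ^ n • b}
        = {n : ℕ | ∃ b : M, p ^ i • x = p ^ n • b} := by
      ext n
      refine ⟨fun ⟨b, hb⟩ ↦ ⟨e.symm b, e.injective ?_⟩, fun ⟨b, hb⟩ ↦ ⟨e b, ?_⟩⟩
      · rw [map_smul, map_smul, e.apply_symm_apply, hb]
      · rw [← map_smul, ← map_smul, hb]
    rw [IsHeight, hset]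
    exact h.isHeight i hi

theorem IsHeightSequence.of_span_eq {x y : M} {l : List ℕ} (h : IsHeightSequence p x l)
    (hxy : Submodule.span R {x} = Submodule.span R {y}) : IsHeightSequence p y l := by
  obtain ⟨r, rfl⟩ := Submodule.mem_span_singleton.1
    (hxy ▸ Submodule.mem_span_singleton_self y : y ∈ Submodule.span R {x})
  obtain ⟨s, hs⟩ := Submodule.mem_span_singleton.1
    (hxy ▸ Submodule.mem_span_singleton_self x : x ∈ Submodule.span R {r • x})
  have hx : ∀ i, s • p ^ i • r • x = p ^ i • x := fun i ↦ by rw [smul_comm, hs]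
  refine ⟨?_, fun i hi h0 ↦ ?_, fun i hi ↦ ?_⟩
  · rw [smul_comm, h.pow_length_smul_eq_zero, smul_zero]
  · exact h.pow_smul_ne_zero i hi (by rw [← hx, h0, smul_zero])
  · have hset : {n : ℕ | ∃ b : M, p ^ i • r • x = p ^ n • b}
        = {n : ℕ | ∃ b : M, p ^ i • x = p ^ n • b} := by
      ext n
      refine ⟨fun ⟨b, hb⟩ ↦ ⟨s • b, ?_⟩, fun ⟨b, hb⟩ ↦ ⟨r • b, ?_⟩⟩
      · rw [← hx, hb, smul_comm]
      · rw [smul_comm, hb, smul_comm]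
    rw [IsHeight, hset]
    exact h.isHeight i hi

theorem IsHeightSequence.of_pairIso {x : M} {y : N} {l : List ℕ} (h : IsHeightSequence p x l)
    (hxy : PairIso (Submodule.span R {x}) (Submodule.span R {y})) : IsHeightSequence p y l := by
  obtain ⟨e, he⟩ := hxy
  rw [Submodule.map_span, Set.image_singleton] at he
  exact (h.map_equiv e).of_span_eq he

theorem isHeightSequence_singleton {x : M} {h : ℕ} (h0 : x ≠ 0) (h1 : p • x = 0)
    (hx : IsHeight p x h) : IsHeightSequence p x [h] where
  pow_length_smul_eq_zero := by simpa using h1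
  pow_smul_ne_zero i hi := by
    obtain rfl : i = 0 := by simpa using hi
    simpa using h0
  isHeight i hi := by
    obtain rfl : i = 0 := by simpa using hi
    simpa using hx

theorem isHeightSequence_pair {x : M} {h k : ℕ} (h0 : p • x ≠ 0) (h1 : p ^ 2 • x = 0)
    (hx : IsHeight p x h) (hpx : IsHeight p (p • x) k) : IsHeightSequence p x [h, k] where
  pow_length_smul_eq_zero := by simpa using h1
  pow_smul_ne_zero i hi := by
    have hi' : i < 2 := by simpa using hi
    interval_cases i
    · rintro hx0
      exact h0 (by rw [← one_smul R x, ← pow_zero p, hx0, smul_zero])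
    · simpa using h0
  isHeight i hi := by
    have hi' : i < 2 := by simpa using hi
    interval_cases i
    · simpa using hx
    · simpa using hpx

theorem exists_maximal_of_bounded {P : ℕ → Prop} (h0 : P 0) {n : ℕ} (hn : ∀ m, n ≤ m → ¬ P m) :
    ∃ m, P m ∧ ∀ k, m < k → ¬ P k := by
  classical
  refine ⟨Nat.findGreatest P n, Nat.findGreatest_spec (Nat.zero_le n) h0, fun k hk hPk ↦ ?_⟩
  rcases le_or_gt n k with h | h
  · exact hn k h hPk
  · exact Nat.findGreatest_is_greatest hk h.le hPk

/-- Divisibility by powers of `p` is bounded on the nonzero elements of a bounded submodule. -/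
theorem IsPowBounded.exists_eq_zero [IsNoetherianRing R] [Module.Finite R M] {A : Submodule R M}
    {m : ℕ} (hA : IsPowBounded p m A) :
    ∃ n : ℕ, ∀ x ∈ A, (∃ b, x = p ^ n • b) → x = 0 := by
  -- Artin–Rees: `p^(k+m) M ∩ A = p^m (p^k M ∩ A) ⊆ p^m A = 0`.
  obtain ⟨k, hk⟩ := Ideal.exists_pow_inf_eq_pow_smul (Ideal.span {p}) A
  refine ⟨k + m, fun x hx hb ↦ ?_⟩
  obtain ⟨b, hb⟩ := hb
  have hmem : x ∈ Ideal.span {p} ^ (k + m) • (⊤ : Submodule R M) ⊓ A := by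
    refine ⟨?_, hx⟩
    rw [hb, Ideal.span_singleton_pow]
    exact Submodule.smul_mem_smul (Ideal.mem_span_singleton_self _) trivial
  rw [hk _ (Nat.le_add_right k m), Nat.add_sub_cancel_left, Ideal.span_singleton_pow,
    Submodule.ideal_span_singleton_smul] at hmem
  obtain ⟨y, hy, rfl⟩ := hmem
  exact hA y hy.2

theorem exists_isHeight [IsNoetherianRing R] [Module.Finite R M] {A : Submodule R M} {m : ℕ}
    (hA : IsPowBounded p m A) {x : M} (hx : x ∈ A) (hx0 : x ≠ 0) : ∃ h, IsHeight p x h := by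
  obtain ⟨n, hn⟩ := hA.exists_eq_zero
  obtain ⟨h, hh, hmax⟩ := exists_maximal_of_bounded (P := fun n ↦ ∃ b : M, x = p ^ n • b)
    ⟨x, by simp⟩ (n := n) fun k hk hb ↦ hx0 (hn x hx (exists_pow_smul_of_le hk hb))
  exact ⟨h, isHeight_iff.2 ⟨hh, hmax _ (Nat.lt_succ_self h)⟩⟩

theorem exists_isHeightSequence [IsNoetherianRing R] [Module.Finite R M] {a : M} (ha : a ≠ 0)
    (hA : IsPowBounded p 2 (Submodule.span R {a})) :
    ∃ l : List ℕ, l.length ≤ 2 ∧ IsHeightSequence p a l := by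
  have hmem : a ∈ Submodule.span R {a} := Submodule.mem_span_singleton_self a
  obtain ⟨h, hh⟩ := exists_isHeight hA hmem ha
  by_cases hpa : p • a = 0
  · exact ⟨[h], by simp, isHeightSequence_singleton ha hpa hh⟩
  · obtain ⟨k, hk⟩ := exists_isHeight hA (Submodule.smul_mem _ p hmem) hpa
    exact ⟨[h, k], by simp, isHeightSequence_pair hpa (hA a hmem) hh hk⟩

/-- The choice of an element that generates a direct summand of a `p ^ 2`-bounded pair. -/
theorem exists_splitting_element [IsNoetherianRing R] [Module.Finite R M] {A : Submodule R M}
    (hA : IsPowBounded p 2 A) (hne : A ≠ ⊥) :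
    ∃ (i h k : ℕ) (a : M), i ≤ 1 ∧ a ∈ A ∧ IsPowBounded p (i + 1) A ∧ p ^ i • a ≠ 0 ∧
      IsHeight p a h ∧ IsHeight p (p ^ i • a) k ∧
      ∀ c ∈ A, ∀ d ∈ A, (∃ b, c = p ^ (k + 1) • b) → (∃ b, d = p ^ (h + 1) • b) →
        p ^ i • a ≠ c + p ^ i • d := by
  by_cases h1 : IsPowBounded p 1 A
  · obtain ⟨a, ha, ha0⟩ := A.ne_bot_iff.1 hne
    obtain ⟨h, hh⟩ := exists_isHeight hA ha ha0
    refine ⟨0, h, h, a, by simp, ha, h1, by simpa using ha0, hh, by simpa using hh, ?_⟩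
    rintro _ - _ - ⟨b, rfl⟩ ⟨b', rfl⟩ heq
    refine (isHeight_iff.1 hh).2 ⟨b + b', ?_⟩
    simpa using heq
  · obtain ⟨x, hx, hx0⟩ : ∃ x ∈ A, p • x ≠ 0 := by
      simpa [IsPowBounded] using h1
    obtain ⟨n, hn⟩ := hA.exists_eq_zero
    -- The choice is lexicographic: `k` is maximal over all of `A`, then `h` is maximal among the
    -- elements that attain this `k`.
    obtain ⟨k, ⟨y, hy, hy0, hyk⟩, hkmax⟩ := exists_maximal_of_bounded
      (P := fun n ↦ ∃ x ∈ A, p • x ≠ 0 ∧ ∃ b : M, p • x = p ^ n • b)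
      ⟨x, hx, hx0, p • x, by simp⟩ (n := n) (fun m hm ⟨x, hx, hx0, hb⟩ ↦
        hx0 (hn _ (A.smul_mem p hx) (exists_pow_smul_of_le hm hb)))
    obtain ⟨h, ⟨a, ha, ha0, hak, hah⟩, hhmax⟩ := exists_maximal_of_bounded
      (P := fun n ↦ ∃ x ∈ A, p • x ≠ 0 ∧ (∃ b : M, p • x = p ^ k • b) ∧ ∃ b : M, x = p ^ n • b)
      ⟨y, hy, hy0, hyk, y, by simp⟩ (n := n) (fun m hm ⟨x, hx, hx0, _, hb⟩ ↦
        hx0 (by rw [hn _ hx (exists_pow_smul_of_le hm hb), smul_zero]))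
    refine ⟨1, h, k, a, le_rfl, ha, hA, by simpa using ha0, ?_, ?_, ?_⟩
    · exact isHeight_iff.2 ⟨hah, fun hb ↦ hhmax _ (Nat.lt_succ_self h) ⟨a, ha, ha0, hak, hb⟩⟩
    · rw [pow_one]
      exact isHeight_iff.2 ⟨hak, fun hb ↦ hkmax _ (Nat.lt_succ_self k) ⟨a, ha, ha0, hb⟩⟩
    · intro c hc d hd hck hdh heq
      rw [pow_one] at heq
      have hceq : p • (a - d) = c := by rw [smul_sub, heq, add_sub_cancel_right]
      -- If `c = 0`, then `p d = p a` and `d` beats the maximality of `h`; otherwise `p (a - d) = c`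
      -- beats the maximality of `k`.
      by_cases hc0 : c = 0
      · rw [hc0, zero_add] at heq
        exact hhmax _ (Nat.lt_succ_self h) ⟨d, hd, heq ▸ ha0, heq ▸ hak, hdh⟩
      · exact hkmax _ (Nat.lt_succ_self k) ⟨a - d, A.sub_mem ha hd, hceq ▸ hc0, hceq ▸ hck⟩

end Heights

/-! ### The models of cyclic pairs -/

section Models

variable {Λ : Type u} [CommRing Λ]

namespace QuotPow

variable {p : Λ} {N : Type*} [AddCommGroup N] [Module Λ N]

/-- The map `Λ / p ^ n → N` that takes `1` to an element annihilated by `p ^ n`. -/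
def toModule (n : ℕ) (x : N) (hx : p ^ n • x = 0) : QuotPow p n →ₗ[Λ] N :=
  Submodule.liftQ (Ideal.span {p ^ n}) (LinearMap.toSpanSingleton Λ N x) (by
    rw [Ideal.span_le, Set.singleton_subset_iff]
    exact hx)

theorem toModule_mk (n : ℕ) (x : N) (hx : p ^ n • x = 0) (r : Λ) :
    toModule n x hx (Ideal.Quotient.mk _ r) = r • x := rfl

instance : Subsingleton (QuotPow p 0) :=
  Ideal.Quotient.subsingleton_iff.2 (by simp)

end QuotPow

/-- The exponents of the models of cyclic pairs: `i = 0` for `p A = 0`, and otherwise `i = 1`; `h`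
and `k` are the heights of a generator `a` and of `p ^ i a`; and `n` is the exponent of the second
summand, which is zero unless there is a gap between `h` and `k`. -/
structure IsModelExponents (i h k n : ℕ) : Prop where
  le_one : i ≤ 1
  gap : (n = 0 ∧ h + i = k) ∨ (n = h + 1 ∧ i = 1 ∧ h + 1 < k)

theorem IsModelExponents.add_le {i h k n : ℕ} (H : IsModelExponents i h k n) : h + i ≤ k := by
  rcases H.gap with ⟨_, h⟩ | ⟨_, rfl, h⟩ <;> omega

/-- The ambient module of the model of a cyclic pair. -/
abbrev Model (p : Λ) (k n : ℕ) : Type u := QuotPow p (k + 1) × QuotPow p n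

/-- The generator of the submodule of the model of a cyclic pair. -/
def modelGen (p : Λ) (i h k n : ℕ) : Model p k n :=
  (Ideal.Quotient.mk _ (p ^ (k - i)), Ideal.Quotient.mk _ (p ^ h))

variable {p : Λ} {i h k n : ℕ}

theorem IsModelExponents.pow_smul_modelGen (H : IsModelExponents i h k n) :
    p ^ i • modelGen p i h k n = (Ideal.Quotient.mk _ (p ^ k), 0) := by
  refine Prod.ext ?_ ?_
  · change p ^ i • Ideal.Quotient.mk _ (p ^ (k - i)) = _
    rw [QuotPow.smul_mk, ← pow_add, Nat.add_sub_cancel' (by have := H.add_le; omega)]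
  · change p ^ i • Ideal.Quotient.mk _ (p ^ h) = _
    rw [QuotPow.smul_mk, ← pow_add, QuotPow.mk_eq_zero]
    exact pow_dvd_pow p (by rcases H.gap with ⟨_, h⟩ | ⟨_, rfl, h⟩ <;> omega)

theorem IsModelExponents.pow_succ_smul_modelGen (H : IsModelExponents i h k n) :
    p ^ (i + 1) • modelGen p i h k n = 0 := by
  rw [pow_succ' p i, mul_smul, H.pow_smul_modelGen, Prod.smul_mk, smul_zero, QuotPow.smul_mk,
    ← pow_succ' p k, QuotPow.mk_eq_zero.2 dvd_rfl, Prod.mk_zero_zero]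

theorem IsModelExponents.exists_map {N : Type*} [AddCommGroup N] [Module Λ N]
    (H : IsModelExponents i h k n) {a : N} (ha : p ^ (i + 1) • a = 0) (hh : ∃ b, a = p ^ h • b)
    (hk : ∃ b, p ^ i • a = p ^ k • b) : ∃ ψ : Model p k n →ₗ[Λ] N, ψ (modelGen p i h k n) = a := by
  obtain ⟨c, hc⟩ := hh
  obtain ⟨b, hb⟩ := hk
  rcases H.gap with ⟨rfl, rfl⟩ | ⟨rfl, rfl, hlt⟩
  · refine ⟨QuotPow.toModule (h + i + 1) c ?_ ∘ₗ LinearMap.fst Λ _ _, ?_⟩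
    · rw [add_assoc, add_comm, pow_add, mul_smul, ← hc, ha]
    · rw [LinearMap.comp_apply, LinearMap.fst_apply, modelGen, QuotPow.toModule_mk,
        Nat.add_sub_cancel, hc]
  · have e1 : p ^ (k + 1) • b = 0 := by
      rw [pow_succ', mul_smul, ← hb, ← mul_smul, ← pow_succ', ha]
    have e2 : p ^ (h + 1) • (c - p ^ (k - 1 - h) • b) = 0 := by
      rw [smul_sub, smul_smul, ← pow_add, show h + 1 + (k - 1 - h) = k by omega, ← hb, hc,
        smul_smul, ← pow_add, add_comm 1 h, sub_self]
    -- With `a = p^h c` and `p a = p^k b`, the difference `a - p^(k-1) b` is `p^h (c - p^(k-1-h)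
    -- b)`, which dictates the image of the second generator.
    refine ⟨LinearMap.coprod (QuotPow.toModule (k + 1) b e1) (QuotPow.toModule (h + 1) _ e2), ?_⟩
    rw [LinearMap.coprod_apply, modelGen, QuotPow.toModule_mk, QuotPow.toModule_mk, smul_sub,
      smul_smul, ← pow_add, Nat.add_sub_cancel' (by omega), ← hc]
    abel

variable [IsDomain Λ]

theorem IsModelExponents.pow_smul_modelGen_ne_zero (H : IsModelExponents i h k n) (hp : Prime p) :
    p ^ i • modelGen p i h k n ≠ 0 := by
  rw [H.pow_smul_modelGen]
  exact fun h0 ↦ QuotPow.mk_pow_ne_zero hp (Nat.lt_succ_self k) (congrArg Prod.fst h0)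

theorem IsModelExponents.modelGen_ne_zero (H : IsModelExponents i h k n) (hp : Prime p) :
    modelGen p i h k n ≠ 0 :=
  fun h0 ↦ H.pow_smul_modelGen_ne_zero hp (by rw [h0, smul_zero])

theorem IsModelExponents.isHeight_modelGen (H : IsModelExponents i h k n) (hp : Prime p) :
    IsHeight p (modelGen p i h k n) h := by
  refine isHeight_iff.2 ⟨⟨(Ideal.Quotient.mk _ (p ^ (k - i - h)), 1), ?_⟩, ?_⟩
  · refine Prod.ext ?_ ?_
    · change _ = p ^ h • Ideal.Quotient.mk _ (p ^ (k - i - h))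
      rw [QuotPow.smul_mk, ← pow_add, Nat.add_sub_cancel' (by have := H.add_le; omega)]
      rfl
    · change _ = p ^ h • Ideal.Quotient.mk _ 1
      rw [QuotPow.smul_mk, mul_one]
      rfl
  · rintro ⟨b, hb⟩
    rcases H.gap with ⟨-, hk⟩ | ⟨rfl, -, -⟩
    · refine H.pow_smul_modelGen_ne_zero hp ?_
      have h1 := H.pow_smul_modelGen (p := p)
      rw [hb, smul_smul, ← pow_add] at h1 ⊢
      refine Prod.ext ?_ (congrArg Prod.snd h1 :)
      exact QuotPow.pow_smul_eq_zero (by omega) b.1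
    · refine QuotPow.mk_pow_ne_zero hp (Nat.lt_succ_self h) ((congrArg Prod.snd hb).trans ?_)
      exact QuotPow.pow_smul_eq_zero le_rfl b.2

theorem IsModelExponents.isHeight_pow_smul_modelGen (H : IsModelExponents i h k n)
    (hp : Prime p) : IsHeight p (p ^ i • modelGen p i h k n) k := by
  rw [H.pow_smul_modelGen]
  refine isHeight_iff.2 ⟨⟨(1, 0), ?_⟩, ?_⟩
  · rw [Prod.smul_mk, smul_zero, ← map_one (Ideal.Quotient.mk (Ideal.span {p ^ (k + 1)})),
      QuotPow.smul_mk, mul_one]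
  · rintro ⟨b, hb⟩
    refine QuotPow.mk_pow_ne_zero hp (Nat.lt_succ_self k) ((congrArg Prod.fst hb).trans ?_)
    exact QuotPow.pow_smul_eq_zero le_rfl b.1

/-- The height sequence of the generator of a model. -/
def modelHeights (i h k : ℕ) : List ℕ := if i = 0 then [h] else [h, k]

theorem IsModelExponents.isHeightSequence (H : IsModelExponents i h k n) (hp : Prime p) :
    IsHeightSequence p (modelGen p i h k n) (modelHeights i h k) := by
  have h0 := H.pow_smul_modelGen_ne_zero hp
  have h1 := H.pow_succ_smul_modelGen (p := p)
  have h2 := H.isHeight_modelGen hp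
  have h3 := H.isHeight_pow_smul_modelGen hp
  obtain rfl | rfl : i = 0 ∨ i = 1 := by have := H.le_one; omega
  · exact isHeightSequence_singleton (H.modelGen_ne_zero hp) (by simpa using h1) h2
  · rw [pow_one] at h0 h3
    exact isHeightSequence_pair h0 h1 h2 h3

theorem IsModelExponents.eq_of_modelHeights_eq {i' h' k' n' : ℕ} (H : IsModelExponents i h k n)
    (H' : IsModelExponents i' h' k' n') (heq : modelHeights i h k = modelHeights i' h' k') :
    i = i' ∧ h = h' ∧ k = k' ∧ n = n' := by
  have := H.le_one
  have := H'.le_one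
  have := H.gap
  have := H'.gap
  unfold modelHeights at heq
  split_ifs at heq <;> simp only [List.cons.injEq, reduceCtorEq, and_false, and_true] at heq <;>
    omega

variable [IsPrincipalIdealRing Λ]

theorem isArtinian_model (hp : Prime p) : IsArtinian Λ (Model p k n) :=
  have := QuotPow.isArtinian hp (k + 1)
  have := QuotPow.isArtinian hp n
  inferInstance

/-- The socle of the first summand is generated by `p^i m`, which is fixed, so the first summand
meets the kernel trivially. A kernel element outside it would force `m` to be divisible by
`p^(k-1)`, although its height is `h < k - 1`. -/
theorem IsModelExponents.injective_of_fix (H : IsModelExponents i h k n) (hp : Prime p)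
    (θ : Model p k n →ₗ[Λ] Model p k n) (hθ : θ (modelGen p i h k n) = modelGen p i h k n) :
    Function.Injective θ := by
  have hfst : ∀ x : QuotPow p (k + 1), θ (x, 0) = 0 → x = 0 := by
    intro x hx
    by_contra hx0
    obtain ⟨r, hr⟩ := QuotPow.exists_smul_eq hp hx0
    have h1 : r • (x, (0 : QuotPow p n)) = p ^ i • modelGen p i h k n := by
      rw [H.pow_smul_modelGen, Prod.smul_mk, smul_zero, hr]
    have h2 := congrArg θ h1
    rw [map_smul, map_smul, hx, hθ, smul_zero] at h2
    exact H.pow_smul_modelGen_ne_zero hp h2.symm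
  rw [injective_iff_map_eq_zero]
  rintro ⟨x, y⟩ hxy
  suffices hy : y = 0 by
    subst hy
    rw [hfst x hxy, Prod.mk_zero_zero]
  rcases H.gap with ⟨rfl, -⟩ | ⟨rfl, rfl, hk⟩
  · exact Subsingleton.elim _ _
  -- A multiple of `(x, y)` has second coordinate `p^h`. It lies in the kernel, and its first
  -- coordinate is killed by `p`, hence divisible by `p^k`.
  by_contra hy
  obtain ⟨r, hr⟩ := QuotPow.exists_smul_eq hp hy
  have hs : θ (r • x, Ideal.Quotient.mk _ (p ^ h)) = 0 := by
    rw [← hr, ← Prod.smul_mk, map_smul, hxy, smul_zero]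
  have hpx : p ^ 1 • r • x = 0 := by
    refine hfst _ ?_
    have : p ^ 1 • (r • x, (Ideal.Quotient.mk _ (p ^ h) : QuotPow p (h + 1)))
        = (p ^ 1 • r • x, 0) := by
      rw [Prod.smul_mk, QuotPow.smul_mk, ← pow_add,
        QuotPow.mk_eq_zero.2 (pow_dvd_pow p (Nat.add_comm 1 h).ge)]
    rw [← this, map_smul, hs, smul_zero]
  obtain ⟨z, hz⟩ := QuotPow.exists_eq_pow_smul hp (Nat.le_add_left 1 k) hpx
  rw [Nat.add_sub_cancel] at hz
  -- `m` minus a kernel element lies in `p^(k-1) M`; applying `θ` puts `m` itself there, and `k - 1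
  -- ≥ h + 1` kills the second coordinate.
  have hdiff : modelGen p 1 h k (h + 1) - (r • x, Ideal.Quotient.mk _ (p ^ h))
      = p ^ (k - 1) • ((1 : QuotPow p (k + 1)) - p • z, (0 : QuotPow p (h + 1))) := by
    refine Prod.ext ?_ ?_
    · change Ideal.Quotient.mk _ (p ^ (k - 1)) - r • x = p ^ (k - 1) • (1 - p • z)
      rw [hz, smul_sub, smul_smul, ← pow_succ, Nat.sub_add_cancel (by omega),
        ← map_one (Ideal.Quotient.mk (Ideal.span {p ^ (k + 1)})), QuotPow.smul_mk, mul_one]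
    · rw [Prod.smul_snd, smul_zero]
      exact sub_self _
  have hgen := congrArg θ hdiff
  rw [map_sub, hθ, hs, sub_zero, map_smul] at hgen
  refine QuotPow.mk_pow_ne_zero hp (Nat.lt_succ_self h) ((congrArg Prod.snd hgen).trans ?_)
  exact QuotPow.pow_smul_eq_zero (by omega) _

theorem IsModelExponents.isIndecomposablePair (H : IsModelExponents i h k n) (hp : Prime p) :
    IsIndecomposablePair (Submodule.span Λ {modelGen p i h k n}) := by
  refine isIndecomposablePair_of_rigid (H.modelGen_ne_zero hp) (H.injective_of_fix hp)
    (H.pow_smul_modelGen_ne_zero hp) fun x hx hx0 ↦ ?_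
  obtain ⟨r, rfl⟩ := Submodule.mem_span_singleton.1 hx
  have hr : ¬ p ^ (i + 1) ∣ r := by
    rintro ⟨s, rfl⟩
    rw [mul_comm, mul_smul, H.pow_succ_smul_modelGen, smul_zero] at hx0
    exact hx0 rfl
  obtain ⟨s, t, hst⟩ := QuotPow.exists_dvd_mul_sub hp i hr
  refine Submodule.mem_span_singleton.2 ⟨s, ?_⟩
  rw [smul_smul, ← sub_eq_zero, ← sub_smul, hst, mul_comm, mul_smul, H.pow_succ_smul_modelGen,
    smul_zero]

/-- An indecomposable `p ^ 2`-bounded pair with nonzero submodule is one of the models. -/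
theorem IsIndecomposablePair.exists_model (hp : Prime p) {B : Type*} [AddCommGroup B] [Module Λ B]
    [Module.Finite Λ B] {A : Submodule Λ B} (hA : IsPowBounded p 2 A) (hne : A ≠ ⊥)
    (hind : IsIndecomposablePair A) :
    ∃ i h k n, IsModelExponents i h k n ∧
      PairIso (Submodule.span Λ {modelGen p i h k n}) A := by
  obtain ⟨i, h, k, a, hi, haA, hAi, ha0, hah, hak, hsplit⟩ := exists_splitting_element hA hne
  obtain ⟨n, H⟩ : ∃ n, IsModelExponents i h k n := by
    have hle : h + i ≤ k := by
      obtain ⟨b, rfl⟩ := hah.1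
      exact hak.2 ⟨b, by rw [smul_smul, ← pow_add, add_comm]⟩
    have h0 : i = 0 → h = k := by
      rintro rfl
      rw [pow_zero, one_smul] at hak
      exact hah.unique hak
    by_cases hgap : h + i = k
    · exact ⟨0, hi, Or.inl ⟨rfl, hgap⟩⟩
    · exact ⟨h + 1, hi, Or.inr ⟨rfl, by omega, by omega⟩⟩
  obtain ⟨ψ, hψ⟩ := H.exists_map (hAi a haA) hah.1 hak.1
  -- `D m` is `A ∩ p^m B`, with heights measured in `B`.
  let D (m : ℕ) : Submodule Λ A :=
    (LinearMap.range (LinearMap.lsmul Λ B (p ^ m))).comap A.subtype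
  have hD : ∀ m (x : A), x ∈ D m ↔ ∃ b : B, (x : B) = p ^ m • b := fun m x ↦ by
    simp [D, LinearMap.mem_range, eq_comm]
  obtain ⟨f, hfa, hf⟩ := exists_functional hp i (N := A) (fun x ↦ Subtype.ext (hAi x x.2))
    (D (k + 1) ⊔ (D (h + 1)).map (LinearMap.lsmul Λ A (p ^ i))) ⟨a, haA⟩ (by
      intro hmem
      obtain ⟨c, hc, _, ⟨d, hd, rfl⟩, hcd⟩ := Submodule.mem_sup.1 hmem
      exact hsplit c c.2 d d.2 ((hD _ _).1 hc) ((hD _ _).1 hd) (congrArg Subtype.val hcd).symm)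
  have hfk : ∀ x ∈ D (k + 1), f x = 0 := fun x hx ↦ hf x (Submodule.mem_sup_left hx)
  have hfh : ∀ x ∈ D (h + 1), p ^ i • f x = 0 := fun x hx ↦ by
    rw [← map_smul]
    exact hf _ (Submodule.mem_sup_right ⟨x, hx, rfl⟩)
  let g := QuotPow.toModule (i + 1) (modelGen p i h k n) H.pow_succ_smul_modelGen
  have hg : ∀ y, g y ∈ Submodule.span Λ {modelGen p i h k n} := fun y ↦ by
    obtain ⟨y, rfl⟩ := Ideal.Quotient.mk_surjective y
    exact Submodule.mem_span_singleton.2 ⟨y, rfl⟩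
  obtain ⟨φ₁, hφ₁⟩ := exists_extension_of_submodule hp (k + 1) A
    (LinearMap.fst Λ _ _ ∘ₗ g ∘ₗ f) (fun x hx ↦ by
      rw [LinearMap.comp_apply, LinearMap.comp_apply, hfk x ((hD _ _).2 hx), map_zero, map_zero])
  obtain ⟨φ₂, hφ₂⟩ := exists_extension_of_submodule hp n A
    (LinearMap.snd Λ _ _ ∘ₗ g ∘ₗ f) (fun x hx ↦ by
      rcases H.gap with ⟨rfl, -⟩ | ⟨rfl, rfl, -⟩
      · exact Subsingleton.elim _ _
      -- On `A ∩ p^(h+1) B` the value of `f` is killed by `p`, hence is a multiple of `p`. It goes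
      -- to a multiple of `p m`, whose second coordinate is zero.
      · obtain ⟨z, hz⟩ := QuotPow.exists_eq_pow_smul hp (by omega) (hfh x ((hD _ _).2 hx))
        obtain ⟨r, hr⟩ := Submodule.mem_span_singleton.1 (hg z)
        rw [LinearMap.comp_apply, LinearMap.comp_apply, hz, map_smul, ← hr, smul_comm,
          Nat.add_sub_cancel, H.pow_smul_modelGen, map_smul, LinearMap.snd_apply, smul_zero])
  have hφ : ∀ x : A, LinearMap.prod φ₁ φ₂ x = g (f x) := fun x ↦ Prod.ext (hφ₁ x) (hφ₂ x)
  have := isArtinian_model (k := k) (n := n) hp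
  obtain ⟨e, he, hAe⟩ := hind.exists_equiv_of_rigid (H.modelGen_ne_zero hp)
    (H.injective_of_fix hp) (LinearMap.prod φ₁ φ₂) ψ (hψ ▸ haA) (by
      rw [hψ, hφ ⟨a, haA⟩, hfa]
      exact one_smul Λ _) (fun x hx ↦ hφ ⟨x, hx⟩ ▸ hg _)
  refine ⟨i, h, k, n, H, e, ?_⟩
  rw [Submodule.map_span, Set.image_singleton, hAe, LinearEquiv.coe_coe, he]

end Models

/-! ### Pairs with zero submodule -/

section ZeroSubmodule

variable {Λ : Type u} [CommRing Λ]

theorem eq_of_linearEquiv_quotient {I J : Ideal Λ} (e : (Λ ⧸ I) ≃ₗ[Λ] (Λ ⧸ J)) : I = J := by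
  rw [← Ideal.annihilator_quotient (I := I), ← Ideal.annihilator_quotient (I := J)]
  exact e.annihilator_eq

theorem not_pairIso_bot_of_ne_bot {M N : Type*} [AddCommGroup M] [Module Λ M] [AddCommGroup N]
    [Module Λ N] {A : Submodule Λ M} (hA : A ≠ ⊥) : ¬ PairIso A (⊥ : Submodule Λ N) := by
  rintro ⟨e, he⟩
  exact hA (Submodule.map_eq_bot_iff.1 he)

variable [IsDomain Λ] [IsPrincipalIdealRing Λ]

/-- Any two nonzero elements have a common nonzero multiple: their product if the prime is `0`, the
socle generator `q^n` of `Λ/q^(n+1)` otherwise. -/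
theorem isIndecomposablePair_bot_quotient {Q : Ideal Λ} (hQ : IsPrimeIdealPower Q) :
    IsIndecomposablePair (⊥ : Submodule Λ (Λ ⧸ Q)) := by
  obtain ⟨P, hP, k, hk, rfl⟩ := hQ
  have hne : P ^ k ≠ ⊤ := fun h ↦
    hP.ne_top (top_le_iff.1 (h ▸ Ideal.pow_le_self (by omega)))
  refine ⟨Ideal.Quotient.nontrivial_iff.2 hne, fun M₁ M₂ _ _ hc _ _ _ ↦ ?_⟩
  by_contra! hbot
  obtain ⟨x, hx, hx0⟩ := M₁.ne_bot_iff.1 hbot.1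
  obtain ⟨y, hy, hy0⟩ := M₂.ne_bot_iff.1 hbot.2
  suffices ∃ r s : Λ, r • x = s • y ∧ r • x ≠ 0 by
    obtain ⟨r, s, h, h0⟩ := this
    exact h0 (Submodule.disjoint_def.1 hc.disjoint _ (M₁.smul_mem r hx)
      (h ▸ M₂.smul_mem s hy))
  by_cases hP0 : P = ⊥
  · subst hP0
    obtain ⟨s, rfl⟩ := Ideal.Quotient.mk_surjective x
    obtain ⟨t, rfl⟩ := Ideal.Quotient.mk_surjective y
    have hbk : (⊥ : Ideal Λ) ^ k = ⊥ := by
      rw [← Ideal.zero_eq_bot, zero_pow (by omega)]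
    rw [Ne, Ideal.Quotient.eq_zero_iff_mem, hbk, Ideal.mem_bot] at hx0 hy0
    have hmul : ∀ u v : Λ, u • Ideal.Quotient.mk ((⊥ : Ideal Λ) ^ k) v
      = Ideal.Quotient.mk ((⊥ : Ideal Λ) ^ k) (u * v) := fun _ _ ↦ rfl
    refine ⟨t, s, by rw [hmul, hmul, mul_comm], ?_⟩
    rw [hmul, Ne, Ideal.Quotient.eq_zero_iff_mem, hbk, Ideal.mem_bot]
    exact mul_ne_zero hy0 hx0
  · obtain ⟨q, rfl⟩ := IsPrincipalIdealRing.principal P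
    have hq : Prime q := by
      refine (Ideal.span_singleton_prime ?_).1 hP
      rintro rfl
      exact hP0 (by simp)
    obtain ⟨n, rfl⟩ : ∃ n, k = n + 1 := ⟨k - 1, by omega⟩
    have hpow : Submodule.span Λ {q} ^ (n + 1) = Ideal.span {q ^ (n + 1)} :=
      Ideal.span_singleton_pow q (n + 1)
    -- The types of `x` and `y` depend on the ideal, so it can be rewritten only after they are
    -- reverted.
    clear hc hbot hx hy hne
    revert x y
    rw [hpow]
    intro x hx0 y hy0
    obtain ⟨r, hr⟩ := QuotPow.exists_smul_eq hq hx0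
    obtain ⟨s, hs⟩ := QuotPow.exists_smul_eq hq hy0
    exact ⟨r, s, hr.trans hs.symm, hr ▸ QuotPow.mk_pow_ne_zero hq (Nat.lt_succ_self n)⟩

/-- A finitely generated indecomposable module over a principal ideal domain is `Λ / Q` for a power
`Q` of a prime ideal. -/
theorem IsIndecomposablePair.exists_quotient_equiv {B : Type v} [AddCommGroup B] [Module Λ B]
    [Module.Finite Λ B] (hB : IsIndecomposablePair (⊥ : Submodule Λ B)) :
    ∃ Q : Ideal Λ, IsPrimeIdealPower Q ∧ Nonempty (B ≃ₗ[Λ] (Λ ⧸ Q)) := by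
  classical
  obtain ⟨n, ι, _, q, hq, e, ⟨E⟩⟩ := Module.equiv_free_prod_directSum (R := Λ) (M := B)
  have retract : ∀ Q : Ideal Λ, IsPrimeIdealPower Q →
      ∀ (φ : B →ₗ[Λ] Λ ⧸ Q) (ψ : (Λ ⧸ Q) →ₗ[Λ] B), (∀ x, φ (ψ x) = x) →
        Nonempty (B ≃ₗ[Λ] (Λ ⧸ Q)) := by
    intro Q hQ φ ψ hφψ
    have := (isIndecomposablePair_bot_quotient hQ).1
    obtain ⟨e, -⟩ := hB.exists_equiv_of_retract φ ψ hφψ fun x hx ↦ by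
      rw [(Submodule.mem_bot Λ).1 hx, map_zero, map_zero]
      exact Submodule.zero_mem _
    exact ⟨e.symm⟩
  -- One free coordinate, or one torsion summand with nonzero exponent, is a retract and therefore
  -- all of `B`; if neither exists, `B = 0`.
  by_cases hn : Nonempty (Fin n)
  · obtain ⟨j⟩ := hn
    have hQ : IsPrimeIdealPower (⊥ : Ideal Λ) :=
      ⟨⊥, Ideal.isPrime_bot, 1, le_rfl, (pow_one _).symm⟩
    let b : (Λ ⧸ (⊥ : Ideal Λ)) ≃ₗ[Λ] Λ := Submodule.quotEquivOfEqBot ⊥ rfl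
    refine ⟨⊥, hQ, retract ⊥ hQ
      (b.symm.toLinearMap ∘ₗ Finsupp.lapply j ∘ₗ LinearMap.fst Λ _ _ ∘ₗ E.toLinearMap)
      (E.symm.toLinearMap ∘ₗ LinearMap.inl Λ _ _ ∘ₗ Finsupp.lsingle j ∘ₗ b.toLinearMap)
      fun x ↦ ?_⟩
    simp
  · by_cases he : ∃ j, e j ≠ 0
    · obtain ⟨j, hj⟩ := he
      have hQ : IsPrimeIdealPower (Ideal.span {q j ^ e j}) :=
        ⟨Ideal.span {q j}, (Ideal.span_singleton_prime (hq j).ne_zero).2 (hq j).prime, e j,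
          by omega, (Ideal.span_singleton_pow _ _).symm⟩
      refine ⟨_, hQ, retract _ hQ
        (DirectSum.component Λ ι (fun j ↦ Λ ⧸ Submodule.span Λ {q j ^ e j}) j ∘ₗ
          LinearMap.snd Λ _ _ ∘ₗ E.toLinearMap)
        (E.symm.toLinearMap ∘ₗ LinearMap.inr Λ _ _ ∘ₗ
          DirectSum.lof Λ ι (fun j ↦ Λ ⧸ Submodule.span Λ {q j ^ e j}) j) fun x ↦ ?_⟩
      simp [DirectSum.component.lof_self]
    · push Not at he
      rw [not_nonempty_iff] at hn
      have : ∀ j, Subsingleton (Λ ⧸ Submodule.span Λ {q j ^ e j}) := fun j ↦ by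
        rw [he j]
        exact Ideal.Quotient.subsingleton_iff.2 (by simp)
      have hsub : Subsingleton (DirectSum ι fun j ↦ Λ ⧸ Submodule.span Λ {q j ^ e j}) :=
        ⟨fun x y ↦ DFinsupp.ext fun j ↦ Subsingleton.elim _ _⟩
      have := hB.1
      obtain ⟨x, hx⟩ := exists_ne (0 : B)
      exact absurd (E.injective (Subsingleton.elim _ _)) hx

end ZeroSubmodule

end SubmodulePair

/-! ### The classification -/

theorem mainTheorem5 {Λ : Type u} [CommRing Λ] [IsDomain Λ] [IsPrincipalIdealRing Λ]
    (p : Λ) (hp : Prime p) :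
    -- an indecomposable pair is of exactly one of the two kinds
    (∀ (B : Type v) [AddCommGroup B] [Module Λ B] [Module.Finite Λ B] (A : Submodule Λ B),
      IsPowBounded p 2 A → IsIndecomposablePair A →
      Xor
        (∃! Q : Ideal Λ, IsPrimeIdealPower Q ∧ PairIso A (⊥ : Submodule Λ (Λ ⧸ Q)))
        (∃ a : B, a ≠ 0 ∧ A = Submodule.span Λ {a})) ∧
    -- the height sequence of a generator exists, is unique and has length at most 2
    (∀ (B : Type v) [AddCommGroup B] [Module Λ B] [Module.Finite Λ B] (a : B),
      a ≠ 0 → IsPowBounded p 2 (Submodule.span Λ {a}) →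
      IsIndecomposablePair (Submodule.span Λ {a}) →
      ∃ l : List ℕ, l.length ≤ 2 ∧ ∀ l' : List ℕ, IsHeightSequence p a l' ↔ l' = l) ∧
    -- the height sequence of a generator is a complete isomorphism invariant
    (∀ (B : Type v) [AddCommGroup B] [Module Λ B] [Module.Finite Λ B] (a : B)
      (D : Type w) [AddCommGroup D] [Module Λ D] [Module.Finite Λ D] (c : D),
      a ≠ 0 → IsPowBounded p 2 (Submodule.span Λ {a}) →
      IsIndecomposablePair (Submodule.span Λ {a}) →
      c ≠ 0 → IsPowBounded p 2 (Submodule.span Λ {c}) →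
      IsIndecomposablePair (Submodule.span Λ {c}) →
      ∀ l : List ℕ, IsHeightSequence p a l →
        (PairIso (Submodule.span Λ {a}) (Submodule.span Λ {c}) ↔ IsHeightSequence p c l)) ∧
    -- every power of a prime ideal is realized
    (∀ Q : Ideal Λ, IsPrimeIdealPower Q →
      IsIndecomposablePair (⊥ : Submodule Λ (Λ ⧸ Q))) ∧
    -- height sequences of nonzero elements are nonempty and strictly increasing
    (∀ (M : Type v) [AddCommGroup M] [Module Λ M] (x : M) (l : List ℕ),
      x ≠ 0 → IsHeightSequence p x l → l ≠ [] ∧ l.Pairwise (· < ·)) ∧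
    -- every such sequence of length at most 2 is realized
    (∀ l : List ℕ, l ≠ [] → l.Pairwise (· < ·) → l.length ≤ 2 →
      ∃ (B : Type u) (_ : AddCommGroup B) (_ : Module Λ B) (a : B),
        Module.Finite Λ B ∧ a ≠ 0 ∧ IsPowBounded p 2 (Submodule.span Λ {a}) ∧
        IsIndecomposablePair (Submodule.span Λ {a}) ∧ IsHeightSequence p a l) := by
  refine ⟨?_, ?_, ?_, ?_, ?_, ?_⟩
  · intro B _ _ _ A hA hind
    by_cases hne : A = ⊥
    · subst hne
      refine Or.inl ⟨?_, ?_⟩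
      · obtain ⟨Q, hQ, ⟨e⟩⟩ := hind.exists_quotient_equiv
        refine ⟨Q, ⟨hQ, e, Submodule.map_bot _⟩, ?_⟩
        rintro Q' ⟨-, e', -⟩
        exact eq_of_linearEquiv_quotient (e'.symm.trans e)
      · rintro ⟨a, ha, hspan⟩
        exact ha (Submodule.span_singleton_eq_bot.1 hspan.symm)
    · refine Or.inr ⟨?_, ?_⟩
      · obtain ⟨i, h, k, n, H, e, he⟩ := hind.exists_model hp hA hne
        refine ⟨e (modelGen p i h k n), ?_, ?_⟩
        · rw [Ne, LinearEquiv.map_eq_zero_iff]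
          exact H.modelGen_ne_zero hp
        · rw [← he, Submodule.map_span, Set.image_singleton, LinearEquiv.coe_coe]
      · rintro ⟨Q, ⟨-, hQ⟩, -⟩
        exact not_pairIso_bot_of_ne_bot hne hQ
  · intro B _ _ _ a ha hA _
    obtain ⟨l, hl, hseq⟩ := exists_isHeightSequence ha hA
    exact ⟨l, hl, fun l' ↦ ⟨fun h ↦ h.unique hseq, fun h ↦ h ▸ hseq⟩⟩
  · intro B _ _ _ a D _ _ _ c ha hA hind hc hC hind' l hl
    refine ⟨fun h ↦ hl.of_pairIso h, fun hl' ↦ ?_⟩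
    obtain ⟨i, h, k, n, H, hiso⟩ :=
      hind.exists_model hp hA (mt Submodule.span_singleton_eq_bot.1 ha)
    obtain ⟨i', h', k', n', H', hiso'⟩ :=
      hind'.exists_model hp hC (mt Submodule.span_singleton_eq_bot.1 hc)
    have h1 := ((H.isHeightSequence hp).of_pairIso hiso).unique hl
    have h2 := ((H'.isHeightSequence hp).of_pairIso hiso').unique hl'
    -- The height sequence recovers all four exponents, so both pairs have the same model.
    obtain ⟨rfl, rfl, rfl, rfl⟩ := H.eq_of_modelHeights_eq H' (h1.trans h2.symm)
    exact hiso.symm.trans hiso'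
  · exact fun Q hQ ↦ isIndecomposablePair_bot_quotient hQ
  · exact fun M _ _ x l hx hl ↦ ⟨hl.ne_nil hx, hl.pairwise⟩
  · intro l hne hl hlen
    obtain ⟨i, h, k, n, H, rfl⟩ :
        ∃ i h k n, IsModelExponents i h k n ∧ modelHeights i h k = l := by
      match l, hne, hl, hlen with
      | [h], _, _, _ => exact ⟨0, h, h, 0, ⟨by omega, Or.inl ⟨rfl, rfl⟩⟩, rfl⟩
      | [h, k], _, hl, _ =>
        have hlt : h < k := by simpa using hl
        by_cases hk : h + 1 = k
        · exact ⟨1, h, k, 0, ⟨le_rfl, Or.inl ⟨rfl, hk⟩⟩, rfl⟩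
        · exact ⟨1, h, k, h + 1, ⟨le_rfl, Or.inr ⟨rfl, rfl, by omega⟩⟩, rfl⟩
    refine ⟨Model p k n, inferInstance, inferInstance, modelGen p i h k n, inferInstance,
      H.modelGen_ne_zero hp, fun x hx ↦ ?_, H.isIndecomposablePair hp, H.isHeightSequence hp⟩
    obtain ⟨r, rfl⟩ := Submodule.mem_span_singleton.1 hx
    have hi : i + 1 ≤ 2 := by have := H.le_one; omega
    rw [smul_comm, ← Nat.sub_add_cancel hi, pow_add p (2 - (i + 1)), mul_smul,
      H.pow_succ_smul_modelGen, smul_zero, smul_zero]
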